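/- Conventions. A tensor network is described by its diagram, a hypergraph $G=(V,E,w)$ with the tensors as vertices and the dimensions as edges, $w(e)=\log(\text{size of }e)$; an edge is uncontracted if it has a dangling end. For disjoint $A,B\subseteq V$ let $\mathsf{cut}_G(A,B)$ be the total weight of the edges adjacent to both $A$ and $B$, and $\mathsf{cut}_G(A)$ the total weight of the edges connecting $A$ with $V\setminus A$ together with the uncontracted edges adjacent only to $A$. Contracting the tensors represented by $A$ and $B$ (dense tensors, classical matrix multiplication) costs $\exp\big(\mathsf{cut}_G(A)+\mathsf{cut}_G(B)-\mathsf{cut}_G(A,B)\big)$. A contraction tree is a rooted binary tree whose leaves are the vertices of $G$, each occurring once; its cost is the sum of the costs of its contractions. Data. Let $N\ge 2$ and let $G_D$ represent a vector with a Kronecker product structure: it has vertices $v_1,\dots,v_N$, and its only edges are uncontracted edges $e_1,\dots,e_N$, where $e_j$ has size $s_j$, is adjacent to $v_j$ and is to be sketched. Embeddings. Let $\epsilon>0$ and $0<\delta<1$. An embedding is a tensor network $G_E$ whose diagram is a graph with $N_E$ vertices (each uncontracted edge has one adjacent vertex, each contracted edge has two), among whose uncontracted edges are $e_1,\dots,e_N$,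 along which it is contracted with the data; the other uncontracted edges are the output sketch dimensions. Given an ordering of the vertices of $G_E$, the row size of a vertex $v$ is the product of the sizes of the output edges adjacent to $v$ and of the contracted edges from $v$ to higher vertices. Fix constants $a,b_1,b_2>0$. The embedding is admissible with sketch size $m$ if * (accuracy sufficient condition) for some ordering of the vertices, every vertex has row size at least $a\,N_E\log(1/\delta)/\epsilon^2$, and * there is exactly one output sketch dimension, and its size $m$ satisfies $b_1N_E\log(1/\delta)/\epsilon^2\le m\le b_2N_E\log(1/\delta)/\epsilon^2$. Claim. There is a constant $c>0$, depending only on $a,b_1,b_2$, such that for all $N,\epsilon,\delta$ and $s_1,\dots,s_N$ as above, every admissible embedding $G_E$ with a sketch size $m$ smaller than every $s_j$, and every contraction tree $T_B$ of $(G_D,G_E)$, $$\mathrm{cost}(T_B)\;\ge\; c\Big(\sum_{j=1}^N s_j m+N m^{2.5}\Big)\qquad\text{and}\qquad \mathrm{cost}(T_B)\;\ge\; c\,N\Big(\frac{N\log(1/\delta)}{\epsilon^2}\Big)^{2.5}.$$ That is, $\mathrm{cost}(T_B)=\Omega\big(\sum_j s_jm+Nm^{2.5}\big)$, and in the term $Nm^{2.5}$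 one may take $m=\Omega(N\log(1/\delta)/\epsilon^2)$ whatever the number $N_E$ of tensors of the embedding. -/

import Mathlib

/-- A tensor diagram: an undirected hypergraph with vertices `V` (the tensors) and hyperedges `E`
(the dimensions). An edge is uncontracted when it has a dangling end. Parallel edges are allowed. -/
structure TensorNetwork (V E : Type*) where
  /-- the vertices adjacent to an edge -/
  adj : E → Set V
  /-- the edges with a dangling end, i.e. the uncontracted ones -/
  dangling : Set E
  /-- the dimension size represented by an edge -/
  size : E → ℕ
  adj_nonempty : ∀ e, (adj e).Nonempty
  adj_nontrivial : ∀ e, e ∉ dangling → (adj e).Nontrivial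
  size_pos : ∀ e, 0 < size e

namespace TensorNetwork

variable {V E : Type*}

/-- The weight of an edge: the natural logarithm of its dimension size. -/
noncomputable def weight (G : TensorNetwork V E) (e : E) : ℝ := Real.log (G.size e)

/-- `E(A, B)`: the edges connecting the vertex sets `A` and `B`. -/
def edgesBetween (G : TensorNetwork V E) (A B : Set V) : Set E :=
  {e | (∃ u ∈ A, u ∈ G.adj e) ∧ ∃ v ∈ B, v ∈ G.adj e}

/-- `E(A, *)`: the uncontracted edges adjacent only to `A`. -/
def edgesOut (G : TensorNetwork V E) (A : Set V) : Set E :=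
  {e | e ∈ G.dangling ∧ G.adj e ⊆ A}

/-- `E(A) = E(A, V \ A) ∪ E(A, *)`: the dimensions of the tensor obtained by contracting `A`. -/
def boundary (G : TensorNetwork V E) (A : Set V) : Set E :=
  G.edgesBetween A Aᶜ ∪ G.edgesOut A

open Classical in
/-- The total weight of a set of edges. -/
noncomputable def totalWeight [Fintype E] (G : TensorNetwork V E) (F : Set E) : ℝ :=
  ∑ e : E with e ∈ F, G.weight e

/-- The logarithm of the cost of contracting the tensors represented by disjoint `A` and `B`:
`cut(A) + cut(B) - cut(A, B)`. -/
noncomputable def logCost [Fintype E] (G : TensorNetwork V E) (A B : Set V) : ℝ :=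
  G.totalWeight (G.boundary A) + G.totalWeight (G.boundary B) - G.totalWeight (G.edgesBetween A B)

end TensorNetwork

/-- Rooted binary trees with leaves labelled by `V`. -/
inductive ContractionTree (V : Type*) where
  | leaf (v : V) : ContractionTree V
  | node (l r : ContractionTree V) : ContractionTree V

namespace ContractionTree

variable {V E : Type*}

/-- The set of vertices represented by (the root of) a tree. -/
def verts : ContractionTree V → Set V
  | leaf v => {v}
  | node l r => l.verts ∪ r.verts

/-- At every contraction the two contracted vertex sets are disjoint. -/
def Proper : ContractionTree V → Prop
  | leaf _ => True
  | node l r => l.Proper ∧ r.Proper ∧ Disjoint l.verts r.verts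

/-- The tree contracts the whole vertex set, each vertex occurring as exactly one leaf. -/
def IsFull (t : ContractionTree V) : Prop := t.Proper ∧ t.verts = Set.univ

/-- The cost of a contraction tree: the sum of the costs of its contractions, each performed as a
classical dense matrix multiplication. -/
noncomputable def cost [Fintype E] (G : TensorNetwork V E) : ContractionTree V → ℝ
  | leaf _ => 0
  | node l r => l.cost G + r.cost G + Real.exp (G.logCost l.verts r.verts)

end ContractionTree

/-- The tensor network `(G_D, G_E)` obtained by connecting `D` and `G` along the edges indexed
by `ι`, which are common to both. -/
def TensorNetwork.attach {ι VD FD VE FE : Type*} (D : TensorNetwork VD (ι ⊕ FD))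
    (G : TensorNetwork VE (ι ⊕ FE)) : TensorNetwork (VD ⊕ VE) (ι ⊕ FD ⊕ FE) where
  adj
    | .inl j => Sum.inl '' D.adj (.inl j) ∪ Sum.inr '' G.adj (.inl j)
    | .inr (.inl f) => Sum.inl '' D.adj (.inr f)
    | .inr (.inr f) => Sum.inr '' G.adj (.inr f)
  dangling := {e | match e with
    | .inl _ => False
    | .inr (.inl f) => .inr f ∈ D.dangling
    | .inr (.inr f) => .inr f ∈ G.dangling}
  size
    | .inl j => D.size (.inl j)
    | .inr (.inl f) => D.size (.inr f)
    | .inr (.inr f) => G.size (.inr f)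
  adj_nonempty
    | .inl j => ((D.adj_nonempty (.inl j)).image _).inl
    | .inr (.inl f) => (D.adj_nonempty (.inr f)).image _
    | .inr (.inr f) => (G.adj_nonempty (.inr f)).image _
  adj_nontrivial
    | .inl j, _ => by
        obtain ⟨u, hu⟩ := D.adj_nonempty (.inl j)
        obtain ⟨v, hv⟩ := G.adj_nonempty (.inl j)
        exact ⟨.inl u, .inl ⟨u, hu, rfl⟩, .inr v, .inr ⟨v, hv, rfl⟩, Sum.inl_ne_inr⟩
    | .inr (.inl f), h => (D.adj_nontrivial (.inr f) h).image Sum.inl_injective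
    | .inr (.inr f), h => (G.adj_nontrivial (.inr f) h).image Sum.inr_injective
  size_pos
    | .inl j => D.size_pos (.inl j)
    | .inr (.inl f) => D.size_pos (.inr f)
    | .inr (.inr f) => G.size_pos (.inr f)

/-- The data network of a Kronecker product `x₁ ⊗ ⋯ ⊗ x_N` of vectors of sizes `s j`: the vertex
`v_j` is adjacent to the single uncontracted edge `e_j` of size `s j`, and there are no other
edges. -/
def kroneckerData {N : ℕ} (s : Fin N → ℕ) (hs : ∀ j, 0 < s j) :
    TensorNetwork (Fin N) (Fin N ⊕ Empty) where
  adj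
    | .inl j => {j}
  dangling := Set.univ
  size
    | .inl j => s j
  adj_nonempty
    | .inl j => Set.singleton_nonempty j
  adj_nontrivial _ h := absurd (Set.mem_univ _) h
  size_pos
    | .inl j => hs j

/-- A tensor network embedding: a graph whose edges are the uncontracted edges `Sum.inl j`, `j : ι`,
to be connected with the data (the columns of the embedding matrix), and the remaining
edges `Sum.inr f`, of which the uncontracted ones form the rows of the embedding matrix. Uncontracted
edges have one adjacent vertex, contracted edges have two. -/
structure TNEmbedding (ι V F : Type*) extends TensorNetwork V (ι ⊕ F) where
  input_dangling : ∀ j, Sum.inl j ∈ dangling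
  adj_of_dangling : ∀ e ∈ dangling, ∃ v, adj e = {v}
  adj_of_contracted : ∀ e ∉ dangling, ∃ u v, u ≠ v ∧ adj e = {u, v}

namespace TNEmbedding

variable {ι V F : Type*}

open Classical in
/-- Given an ordering of the vertices of the embedding, the number of rows of the matricization of
the tensor at `v` in the corresponding linearization: its rows combine the output dimensions and
the dimensions contracted with tensors of higher index. (The other dimensions, among them
those connected with the data, are columns.) -/
noncomputable def rowSize [Fintype V] [Fintype F] (G : TNEmbedding ι V F)
    (ord : V ≃ Fin (Fintype.card V)) (v : V) : ℕ :=
  ∏ f : F with v ∈ G.adj (Sum.inr f) ∧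
    (Sum.inr f ∈ G.dangling ∨ ∃ u ∈ G.adj (Sum.inr f), ord v < ord u), G.size (Sum.inr f)

/-- The accuracy sufficient condition, with constant `a` in its `Ω`: in some linearization every
tensor has row size at least `a * N_E * log (1 / δ) / ε ^ 2`, where `N_E` is the number of tensors
of the embedding. -/
def SufficientCondition [Fintype V] [Fintype F] (G : TNEmbedding ι V F) (a ε δ : ℝ) : Prop :=
  ∃ ord : V ≃ Fin (Fintype.card V), ∀ v,
    a * (Fintype.card V * Real.log (1 / δ) / ε ^ 2) ≤ G.rowSize ord v

/-- There is exactly one output sketch dimension, and it has size `m`. -/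
def HasOutputSize (G : TNEmbedding ι V F) (m : ℕ) : Prop :=
  ∃ f, (∀ f', Sum.inr f' ∈ G.dangling ↔ f' = f) ∧ G.size (Sum.inr f) = m

/-- The admissible embeddings of sketch size `m`: they satisfy the sufficient condition, and have
one output sketch dimension, of size `m = Θ(N_E * log (1 / δ) / ε ^ 2)`. The constants in `Ω` and
`Θ` are `a` and `b₁, b₂`. -/
structure Admissible [Fintype V] [Fintype F] (G : TNEmbedding ι V F) (a b₁ b₂ ε δ : ℝ) (m : ℕ) :
    Prop where
  sufficient : G.SufficientCondition a ε δ
  output : G.HasOutputSize m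
  lower : b₁ * (Fintype.card V * Real.log (1 / δ) / ε ^ 2) ≤ m
  upper : m ≤ b₂ * (Fintype.card V * Real.log (1 / δ) / ε ^ 2)

end TNEmbedding

/-!
Contracting disjoint `A` and `B` costs the product of the sizes of all the dimensions of their two
tensors. The tensor of a single vertex `v` has as dimensions its outgoing edges, of total size the
row size of `v`, and the partner contributes at least the outgoing edges of its highest vertex.
Since every vertex is contracted once and a contraction consumes at most two vertices, the
outgoing edges `e_j` of the data vertices, placed lowest in the ordering, give the term
`∑ j, s j * m`.

For `N * m ^ 2.5`, let every row size be at least `exp ℓ`, and consider a contraction that costs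
less than `exp (5 / 2 * ℓ)`. The highest vertices of the two parts already account for `2 * ℓ`, so
the other outgoing dimensions have total weight less than `ℓ / 2`. The part with the lower highest
vertex therefore sends most of its outgoing edges into the other part, so such contractions hardly
gather any of the vertices without ingoing edges, among them the `N` data vertices.

If many data vertices are attached to one tensor of the embedding, that tensor itself is
exponentially large in their number. A power mean over the tensors of the embedding thus replaces
`m`, which is proportional to `N_E`, by the same multiple of `N`.
-/

namespace TensorNetwork

variable {V E : Type*}

section TotalWeight

variable (G : TensorNetwork V E)

lemma weight_nonneg (e : E) : 0 ≤ G.weight e :=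
  Real.log_nonneg (by exact_mod_cast G.size_pos e)

variable [Fintype E]

lemma totalWeight_eq_sum_indicator (F : Set E) : G.totalWeight F = ∑ e, F.indicator G.weight e := by
  classical
  simp only [totalWeight, Finset.sum_filter, Set.indicator_apply]

lemma totalWeight_empty : G.totalWeight ∅ = 0 := by
  simp [totalWeight_eq_sum_indicator]

lemma totalWeight_nonneg (F : Set E) : 0 ≤ G.totalWeight F :=
  Finset.sum_nonneg fun e _ => G.weight_nonneg e

lemma totalWeight_mono {F F' : Set E} (h : F ⊆ F') : G.totalWeight F ≤ G.totalWeight F' := by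
  simp only [totalWeight_eq_sum_indicator]
  exact Finset.sum_le_sum fun e _ => Set.indicator_le_indicator_of_subset h G.weight_nonneg e

lemma totalWeight_union_add_inter (F F' : Set E) :
    G.totalWeight (F ∪ F') + G.totalWeight (F ∩ F') = G.totalWeight F + G.totalWeight F' := by
  simp only [totalWeight_eq_sum_indicator, ← Finset.sum_add_distrib]
  exact Finset.sum_congr rfl fun e _ => congrFun (Set.indicator_union_add_inter G.weight F F') e

lemma totalWeight_union {F F' : Set E} (h : Disjoint F F') :
    G.totalWeight (F ∪ F') = G.totalWeight F + G.totalWeight F' := by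
  rw [← totalWeight_union_add_inter, h.inter_eq, totalWeight_empty, add_zero]

lemma totalWeight_union_le (F F' : Set E) :
    G.totalWeight (F ∪ F') ≤ G.totalWeight F + G.totalWeight F' := by
  linarith [G.totalWeight_union_add_inter F F', G.totalWeight_nonneg (F ∩ F')]

lemma totalWeight_add_le {F F' K : Set E} (h : Disjoint F F') (hF : F ⊆ K) (hF' : F' ⊆ K) :
    G.totalWeight F + G.totalWeight F' ≤ G.totalWeight K :=
  (G.totalWeight_union h).symm.trans_le (G.totalWeight_mono (Set.union_subset hF hF'))

lemma prod_size_le_exp_totalWeight {ι : Type*} (s : Finset ι) (g : ι ↪ E) {F : Set E}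
    (h : ∀ i ∈ s, g i ∈ F) : ∏ i ∈ s, (G.size (g i) : ℝ) ≤ Real.exp (G.totalWeight F) := by
  have hpos : ∀ e, (0 : ℝ) < G.size e := fun e => by exact_mod_cast G.size_pos e
  rw [← Real.log_le_iff_le_exp (Finset.prod_pos fun i _ => hpos _),
    Real.log_prod fun i _ => (hpos _).ne', ← Finset.sum_map s g fun e => Real.log (G.size e)]
  refine Finset.sum_le_sum_of_subset_of_nonneg ?_ fun e _ _ => G.weight_nonneg e
  intro e he
  obtain ⟨i, hi, rfl⟩ := Finset.mem_map.mp he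
  simpa using h i hi

end TotalWeight

section Boundary

variable (G : TensorNetwork V E)

lemma mem_boundary_iff {A : Set V} {e : E} :
    e ∈ G.boundary A ↔ (∃ v ∈ A, v ∈ G.adj e) ∧ (e ∈ G.dangling ∨ ∃ v ∉ A, v ∈ G.adj e) := by
  have hne := G.adj_nonempty e
  simp only [boundary, edgesBetween, edgesOut, Set.mem_union, Set.mem_ofPred_eq, Set.mem_compl_iff,
    Set.subset_def, Set.Nonempty] at hne ⊢
  grind

lemma boundary_union_subset (A B : Set V) : G.boundary (A ∪ B) ⊆ G.boundary A ∪ G.boundary B := by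
  intro e
  simp only [Set.mem_union, mem_boundary_iff]
  grind

lemma edgesBetween_eq_inter_boundary {A B : Set V} (hAB : Disjoint A B) :
    G.edgesBetween A B = G.boundary A ∩ G.boundary B := by
  have hd : ∀ v ∈ A, v ∉ B := fun _ hv => hAB.notMem_of_mem_left hv
  ext e
  simp only [edgesBetween, Set.mem_ofPred_eq, Set.mem_inter_iff, mem_boundary_iff]
  grind

variable [Fintype E]

lemma logCost_eq {A B : Set V} (hAB : Disjoint A B) :
    G.logCost A B = G.totalWeight (G.boundary A ∪ G.boundary B) := by
  rw [logCost, edgesBetween_eq_inter_boundary G hAB, ← totalWeight_union_add_inter,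
    add_sub_cancel_right]

lemma logCost_comm {A B : Set V} (hAB : Disjoint A B) : G.logCost B A = G.logCost A B := by
  rw [G.logCost_eq hAB, G.logCost_eq hAB.symm, Set.union_comm]

lemma totalWeight_boundary_le_logCost {A B : Set V} (hAB : Disjoint A B) :
    G.totalWeight (G.boundary A) ≤ G.logCost A B := by
  rw [G.logCost_eq hAB]
  exact G.totalWeight_mono Set.subset_union_left

end Boundary

end TensorNetwork

namespace ContractionTree

variable {V E : Type*} [Fintype E] {G : TensorNetwork V E}

lemma verts_nonempty : ∀ t : ContractionTree V, t.verts.Nonempty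
  | leaf v => Set.singleton_nonempty v
  | node l _ => l.verts_nonempty.inl

lemma finsum_verts_le_two_mul_cost_add [Finite V] {ψ : V → ℝ}
    (hψ : ∀ v B, B.Nonempty → v ∉ B → ψ v ≤ Real.exp (G.logCost {v} B)) :
    ∀ t : ContractionTree V, t.Proper → ∀ B : Set V, B.Nonempty → Disjoint t.verts B →
      ∑ᶠ v ∈ t.verts, ψ v ≤ 2 * t.cost G + Real.exp (G.logCost t.verts B)
  | leaf v, _, B, hB, hvB => by
      simpa [verts, cost] using hψ v B hB (Set.disjoint_singleton_left.mp hvB)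
  | node l r, ⟨hl, hr, hlr⟩, B, _, _ => by
      have ihl := finsum_verts_le_two_mul_cost_add hψ l hl r.verts r.verts_nonempty hlr
      have ihr := finsum_verts_le_two_mul_cost_add hψ r hr l.verts l.verts_nonempty hlr.symm
      rw [G.logCost_comm hlr] at ihr
      rw [verts, finsum_mem_union hlr (Set.toFinite _) (Set.toFinite _), cost]
      linarith [Real.exp_pos (G.logCost (l.verts ∪ r.verts) B)]

/-- Every leaf is charged to the contraction that consumes it, and a contraction consumes at most
two leaves. -/
lemma IsFull.sum_le_two_mul_cost [Fintype V] [Nontrivial V] {T : ContractionTree V} (hT : T.IsFull)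
    {ψ : V → ℝ} (hψ : ∀ v B, B.Nonempty → v ∉ B → ψ v ≤ Real.exp (G.logCost {v} B)) :
    ∑ v, ψ v ≤ 2 * T.cost G := by
  rw [← finsum_eq_sum_of_fintype, ← finsum_mem_univ, ← hT.2]
  cases T with
  | leaf v => exact absurd hT.2 (Set.singleton_ne_univ v)
  | node l r =>
    obtain ⟨hl, hr, hlr⟩ := hT.1
    have hl := finsum_verts_le_two_mul_cost_add hψ l hl r.verts r.verts_nonempty hlr
    have hr := finsum_verts_le_two_mul_cost_add hψ r hr l.verts l.verts_nonempty hlr.symm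
    rw [G.logCost_comm hlr] at hr
    rw [verts, finsum_mem_union hlr (Set.toFinite _) (Set.toFinite _), cost]
    linarith

lemma IsFull.sum_exp_boundary_le_cost [Fintype V] [Nontrivial V] {T : ContractionTree V}
    (hT : T.IsFull) : ∑ v, Real.exp (G.totalWeight (G.boundary {v})) ≤ 2 * T.cost G :=
  hT.sum_le_two_mul_cost fun _ _ _ hvB => Real.exp_le_exp.mpr
    (G.totalWeight_boundary_le_logCost (Set.disjoint_singleton_left.mpr hvB))

end ContractionTree

namespace TensorNetwork

/-! ### Graphs with ordered vertices -/

variable {V E α : Type*} [LinearOrder α]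

/-- The diagram of the network is a graph: an uncontracted edge has one adjacent vertex, a
contracted edge has two. -/
structure IsGraph (G : TensorNetwork V E) : Prop where
  adj_of_dangling : ∀ e ∈ G.dangling, ∃ v, G.adj e = {v}
  adj_of_contracted : ∀ e ∉ G.dangling, ∃ u v, u ≠ v ∧ G.adj e = {u, v}

/-- The edges going up or out from `v`, in the ordering of the vertices by the rank `r`. In an
embedding, the product of their sizes is the row size of `v`. -/
def outEdges (G : TensorNetwork V E) (r : V ↪ α) (v : V) : Set E :=
  {e | v ∈ G.adj e ∧ (e ∈ G.dangling ∨ ∃ u ∈ G.adj e, r v < r u)}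

/-- The dimensions of the contraction of `A` that go up or out from their vertex in `A`. -/
def leaving (G : TensorNetwork V E) (r : V ↪ α) (A : Set V) : Set E :=
  {e ∈ G.boundary A | ∃ v ∈ A, e ∈ G.outEdges r v}

/-- The dimensions of the contraction of `A` that go down from `A`. -/
def entering (G : TensorNetwork V E) (r : V ↪ α) (A : Set V) : Set E :=
  G.boundary A \ G.leaving r A

/-- The edges leaving `A` from a vertex other than the highest one. -/
def lowLeaving (G : TensorNetwork V E) (r : V ↪ α) (A : Set V) : Set E :=
  {e ∈ G.boundary A | ∃ v ∈ A, e ∈ G.outEdges r v ∧ ∃ u ∈ A, r v < r u}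

/-- The vertices all of whose edges go up or out. -/
def sources (G : TensorNetwork V E) (r : V ↪ α) : Set V :=
  {v | ∀ e, v ∈ G.adj e → e ∈ G.outEdges r v}

variable {G : TensorNetwork V E} {r : V ↪ α} {A B : Set V} {a b : V}

lemma IsGraph.eq_of_mem_outEdges (hG : G.IsGraph) {e : E} {u v : V} (hu : e ∈ G.outEdges r u)
    (hv : e ∈ G.outEdges r v) : u = v := by
  obtain ⟨hue, hu⟩ := hu
  obtain ⟨hve, hv⟩ := hv
  by_cases he : e ∈ G.dangling
  · obtain ⟨w, hw⟩ := hG.adj_of_dangling e he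
    rw [hw] at hue hve
    exact hue.trans hve.symm
  · obtain ⟨w, w', -, hw⟩ := hG.adj_of_contracted e he
    simp only [hw, Set.mem_insert_iff, Set.mem_singleton_iff, he, false_or] at hue hve hu hv
    grind

lemma leaving_subset_boundary : G.leaving r A ⊆ G.boundary A := Set.sep_subset _ _

lemma entering_subset_boundary : G.entering r A ⊆ G.boundary A := Set.sdiff_subset

lemma lowLeaving_subset_leaving : G.lowLeaving r A ⊆ G.leaving r A :=
  fun _ ⟨he, v, hv, hev, _⟩ => ⟨he, v, hv, hev⟩

lemma outEdges_subset_leaving (ha : a ∈ A) (hmax : IsMaxOn r A a) :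
    G.outEdges r a ⊆ G.leaving r A := by
  refine fun e he => ⟨(G.mem_boundary_iff).mpr ⟨⟨a, ha, he.1⟩, ?_⟩, a, ha, he⟩
  refine he.2.imp_right fun ⟨u, hu, hau⟩ => ⟨u, fun huA => ?_, hu⟩
  exact (isMaxOn_iff.mp hmax u huA).not_gt hau

lemma outEdges_subset_boundary (ha : a ∈ A) (hmax : IsMaxOn r A a) :
    G.outEdges r a ⊆ G.boundary A :=
  (outEdges_subset_leaving ha hmax).trans leaving_subset_boundary

lemma outEdges_subset_boundary_singleton : G.outEdges r a ⊆ G.boundary {a} :=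
  outEdges_subset_boundary rfl (by simp [isMaxOn_iff])

lemma exists_isMaxOn [Finite V] (r : V ↪ α) (hA : A.Nonempty) : ∃ a ∈ A, IsMaxOn r A a :=
  Set.exists_max_image A r A.toFinite hA

lemma IsGraph.disjoint_outEdges_lowLeaving (hG : G.IsGraph) (hmax : IsMaxOn r A a) :
    Disjoint (G.outEdges r a) (G.lowLeaving r A) := by
  refine Set.disjoint_left.mpr fun e he ⟨_, v, _, hev, u, hu, hvu⟩ => ?_
  obtain rfl := hG.eq_of_mem_outEdges he hev
  exact (isMaxOn_iff.mp hmax u hu).not_gt hvu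

lemma IsGraph.disjoint_leaving (hG : G.IsGraph) (hAB : Disjoint A B) :
    Disjoint (G.leaving r A) (G.leaving r B) := by
  refine Set.disjoint_left.mpr fun e ⟨_, u, hu, heu⟩ ⟨_, v, hv, hev⟩ => ?_
  exact hAB.ne_of_mem hu hv (hG.eq_of_mem_outEdges heu hev)

section Weights

variable [Fintype E]

lemma IsGraph.outEdges_add_lowLeaving_le (hG : G.IsGraph) (ha : a ∈ A) (hmax : IsMaxOn r A a) :
    G.totalWeight (G.outEdges r a) + G.totalWeight (G.lowLeaving r A) ≤
      G.totalWeight (G.leaving r A) :=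
  G.totalWeight_add_le (hG.disjoint_outEdges_lowLeaving hmax) (outEdges_subset_leaving ha hmax)
    lowLeaving_subset_leaving

lemma IsGraph.leaving_add_leaving_add_entering_le_logCost (hG : G.IsGraph) (hAB : Disjoint A B) :
    G.totalWeight (G.leaving r A) + G.totalWeight (G.leaving r B) +
      G.totalWeight (G.entering r (A ∪ B)) ≤ G.logCost A B := by
  rw [G.logCost_eq hAB, ← G.totalWeight_union (hG.disjoint_leaving hAB)]
  refine G.totalWeight_add_le (Set.disjoint_left.mpr ?_)
    (Set.union_subset_union leaving_subset_boundary leaving_subset_boundary)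
    (entering_subset_boundary.trans (G.boundary_union_subset A B))
  rintro e (⟨_, v, hv, hev⟩ | ⟨_, v, hv, hev⟩) ⟨heb, he⟩
  · exact he ⟨heb, v, .inl hv, hev⟩
  · exact he ⟨heb, v, .inr hv, hev⟩

lemma IsGraph.leaving_le_entering_add_lowLeaving_union (hG : G.IsGraph) (hAB : Disjoint A B)
    (hb : b ∈ B) (hlt : ∀ u ∈ A, r u < r b) :
    G.totalWeight (G.leaving r A) ≤
      G.totalWeight (G.entering r B) + G.totalWeight (G.lowLeaving r (A ∪ B)) := by
  refine (G.totalWeight_mono fun e he => ?_).trans (G.totalWeight_union_le _ _)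
  obtain ⟨heA, v, hv, hev⟩ := id he
  by_cases heAB : e ∈ G.boundary (A ∪ B)
  · exact .inr ⟨heAB, v, .inl hv, hev, b, .inr hb, hlt v hv⟩
  · refine .inl ⟨?_, (hG.disjoint_leaving hAB).notMem_of_mem_left he⟩
    have hd : ∀ v ∈ A, v ∉ B := fun _ hv => hAB.notMem_of_mem_left hv
    simp only [mem_boundary_iff, Set.mem_union] at heA heAB ⊢
    grind

/-- A bound of the number of sources in `A` by the cost `c` of contracting `A`, in units of
`exp (5 / 2 * ℓ)`. Contractions of at least that cost pay for their sources, and the bound carries a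
debt of at most two sources for the cheaper ones. The debt is smaller when `A` has few low outgoing
dimensions and vanishes when it has many incoming ones. -/
structure SourceBound (G : TensorNetwork V E) (r : V ↪ α) (ℓ : ℝ) (A : Set V) (c : ℝ) : Prop where
  le_add_two : Real.exp (5 / 2 * ℓ) * (A ∩ G.sources r).ncard ≤ 4 * c + 2 * Real.exp (5 / 2 * ℓ)
  le_add_one : G.totalWeight (G.lowLeaving r A) < ℓ / 2 →
    Real.exp (5 / 2 * ℓ) * (A ∩ G.sources r).ncard ≤ 4 * c + Real.exp (5 / 2 * ℓ)
  le : ℓ / 2 ≤ G.totalWeight (G.entering r A) →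
    Real.exp (5 / 2 * ℓ) * (A ∩ G.sources r).ncard ≤ 4 * c

lemma sourceBound_singleton {ℓ : ℝ} (hℓ : 0 < ℓ) (v : V) : G.SourceBound r ℓ {v} 0 := by
  have hle : ({v} ∩ G.sources r).ncard ≤ 1 := by
    simpa using Set.ncard_le_ncard (Set.inter_subset_left (s := {v}) (t := G.sources r))
  have hle' : Real.exp (5 / 2 * ℓ) * ({v} ∩ G.sources r).ncard ≤ Real.exp (5 / 2 * ℓ) :=
    mul_le_of_le_one_right (Real.exp_nonneg _) (by exact_mod_cast hle)
  have hpos := Real.exp_pos (5 / 2 * ℓ)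
  refine ⟨by linarith, fun _ => by linarith, fun hent => ?_⟩
  have hv : v ∉ G.sources r := fun hv => by
    have : G.entering r {v} = ∅ := by
      refine Set.eq_empty_of_forall_notMem fun e ⟨he, hleav⟩ => hleav ⟨he, v, rfl, hv e ?_⟩
      simpa using (G.mem_boundary_iff.mp he).1
    rw [this, totalWeight_empty] at hent
    linarith
  simp [Set.singleton_inter_eq_empty.mpr hv]

lemma SourceBound.union [Finite V] (hG : G.IsGraph) {ℓ cA cB : ℝ}
    (hout : ∀ v, ℓ ≤ G.totalWeight (G.outEdges r v)) (hA : G.SourceBound r ℓ A cA)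
    (hB : G.SourceBound r ℓ B cB) (hAB : Disjoint A B) (ha : a ∈ A) (hamax : IsMaxOn r A a)
    (hb : b ∈ B) (hbmax : IsMaxOn r B b) (hab : r a < r b) :
    G.SourceBound r ℓ (A ∪ B) (cA + cB + Real.exp (G.logCost A B)) := by
  have hcard : (((A ∪ B) ∩ G.sources r).ncard : ℝ) =
      (A ∩ G.sources r).ncard + (B ∩ G.sources r).ncard := by
    rw [Set.union_inter_distrib_right,
      Set.ncard_union_eq (hAB.mono Set.inter_subset_left Set.inter_subset_left), Nat.cast_add]
  have hX := Real.exp_pos (5 / 2 * ℓ)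
  have hC := Real.exp_pos (G.logCost A B)
  rcases le_or_gt (5 / 2 * ℓ) (G.logCost A B) with hexp | hcheap
  · have hXC : Real.exp (5 / 2 * ℓ) ≤ Real.exp (G.logCost A B) := Real.exp_le_exp.mpr hexp
    have hpaid : Real.exp (5 / 2 * ℓ) * ((A ∪ B) ∩ G.sources r).ncard ≤
        4 * (cA + cB + Real.exp (G.logCost A B)) := by
      rw [hcard]
      linarith [hA.le_add_two, hB.le_add_two]
    exact ⟨by linarith, fun _ => by linarith, fun _ => hpaid⟩
  -- Little is left of the budget after the outgoing edges of `a` and `b`. As `b` is the higher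
  -- one, most of what leaves `A` enters `B`, and the sources of `B` are already paid for.
  · have hlowA := hG.outEdges_add_lowLeaving_le ha hamax
    have hlowB := hG.outEdges_add_lowLeaving_le hb hbmax
    have hsum : G.totalWeight (G.lowLeaving r A) + G.totalWeight (G.lowLeaving r B) +
        G.totalWeight (G.entering r (A ∪ B)) < ℓ / 2 := by
      linarith [hG.leaving_add_leaving_add_entering_le_logCost (r := r) hAB, hout a, hout b]
    have hlA := G.totalWeight_nonneg (G.lowLeaving r A)
    have hlB := G.totalWeight_nonneg (G.lowLeaving r B)
    have hent := G.totalWeight_nonneg (G.entering r (A ∪ B))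
    have boundA := hA.le_add_one (by linarith)
    have boundB := hB.le_add_one (by linarith)
    refine ⟨by rw [hcard]; linarith, fun hlow => ?_, fun hi => by linarith⟩
    have hentB : ℓ / 2 ≤ G.totalWeight (G.entering r B) := by
      linarith [hout a, hG.leaving_le_entering_add_lowLeaving_union hAB hb
        fun u hu => (isMaxOn_iff.mp hamax u hu).trans_lt hab]
    rw [hcard]
    linarith [hB.le hentB]

lemma IsGraph.sourceBound_verts [Finite V] (hG : G.IsGraph) {ℓ : ℝ} (hℓ : 0 < ℓ)
    (hout : ∀ v, ℓ ≤ G.totalWeight (G.outEdges r v)) :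
    ∀ t : ContractionTree V, t.Proper → G.SourceBound r ℓ t.verts (t.cost G)
  | .leaf v, _ => sourceBound_singleton hℓ v
  | .node t t', ⟨ht, ht', hd⟩ => by
      have bound := hG.sourceBound_verts hℓ hout t ht
      have bound' := hG.sourceBound_verts hℓ hout t' ht'
      obtain ⟨a, ha, hamax⟩ := exists_isMaxOn r t.verts_nonempty
      obtain ⟨b, hb, hbmax⟩ := exists_isMaxOn r t'.verts_nonempty
      rcases (r.injective.ne (hd.ne_of_mem ha hb)).lt_or_gt with hab | hba
      · exact bound.union hG hout bound' hd ha hamax hb hbmax hab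
      · have h := bound'.union hG hout bound hd.symm hb hbmax ha hamax hba
        rwa [Set.union_comm, add_comm (t'.cost G), G.logCost_comm hd] at h

theorem IsGraph.exp_mul_ncard_sources_le_cost [Finite V] (hG : G.IsGraph) {ℓ : ℝ} (hℓ : 0 < ℓ)
    (hout : ∀ v, ℓ ≤ G.totalWeight (G.outEdges r v)) (hdang : G.dangling.Subsingleton)
    {T : ContractionTree V} (hT : T.IsFull) :
    Real.exp (5 / 2 * ℓ) * (G.sources r).ncard ≤ 4 * T.cost G + Real.exp (5 / 2 * ℓ) := by
  have hbound := hG.sourceBound_verts hℓ hout T hT.1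
  rw [hT.2] at hbound
  -- The only dimension of the whole network leaves from its highest vertex.
  suffices hlow : G.lowLeaving r Set.univ = ∅ by
    simpa using hbound.le_add_one (by rw [hlow, totalWeight_empty]; linarith)
  obtain ⟨t, ht, htmax⟩ := exists_isMaxOn r (hT.2 ▸ T.verts_nonempty)
  have hdang_of_mem : ∀ e ∈ G.boundary Set.univ, e ∈ G.dangling := fun e he => by
    simpa using (G.mem_boundary_iff.mp he).2
  obtain ⟨e, he⟩ : (G.outEdges r t).Nonempty := by
    by_contra hempty
    have := hout t
    rw [Set.not_nonempty_iff_eq_empty.mp hempty, totalWeight_empty] at this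
    linarith
  refine Set.eq_empty_of_forall_notMem fun f hf => ?_
  have hef : e = f := hdang (hdang_of_mem e (outEdges_subset_boundary ht htmax he))
    (hdang_of_mem f hf.1)
  exact (hG.disjoint_outEdges_lowLeaving htmax).notMem_of_mem_left he (hef ▸ hf)

theorem IsGraph.exp_mul_sum_exp_outEdges_le_cost [Fintype V] [Nontrivial V] (hG : G.IsGraph)
    {ℓ : ℝ} (hout : ∀ v, ℓ ≤ G.totalWeight (G.outEdges r v)) {T : ContractionTree V}
    (hT : T.IsFull) :
    Real.exp ℓ * ∑ v, Real.exp (G.totalWeight (G.outEdges r v)) ≤ 2 * T.cost G := by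
  rw [Finset.mul_sum]
  refine hT.sum_le_two_mul_cost fun v B hB hvB => ?_
  obtain ⟨b, hb, hbmax⟩ := exists_isMaxOn r hB
  have hdisj : Disjoint (G.outEdges r v) (G.outEdges r b) := Set.disjoint_left.mpr
    fun e hev heb => hvB (hG.eq_of_mem_outEdges hev heb ▸ hb)
  rw [← Real.exp_add, Real.exp_le_exp, G.logCost_eq (Set.disjoint_singleton_left.mpr hvB)]
  have := G.totalWeight_add_le hdisj
    (outEdges_subset_boundary_singleton.trans Set.subset_union_left)
    ((outEdges_subset_boundary hb hbmax).trans Set.subset_union_right)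
  linarith [hout b]

end Weights

end TensorNetwork

/-! ### Embeddings contracted with Kronecker products -/

lemma isGraph_kroneckerData {N : ℕ} (s : Fin N → ℕ) (hs : ∀ j, 0 < s j) :
    (kroneckerData s hs).IsGraph where
  adj_of_dangling
    | .inl j, _ => ⟨j, rfl⟩
  adj_of_contracted _ h := absurd (Set.mem_univ _) h

lemma TensorNetwork.IsGraph.attach {ι VD FD VE FE : Type*} {D : TensorNetwork VD (ι ⊕ FD)}
    {G : TensorNetwork VE (ι ⊕ FE)} (hD : D.IsGraph) (hG : G.IsGraph)
    (hDι : ∀ j, Sum.inl j ∈ D.dangling) (hGι : ∀ j, Sum.inl j ∈ G.dangling) :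
    (D.attach G).IsGraph where
  adj_of_dangling
    | .inr (.inl f), h => by
        obtain ⟨v, hv⟩ := hD.adj_of_dangling _ h
        exact ⟨.inl v, by simp only [TensorNetwork.attach, hv, Set.image_singleton]⟩
    | .inr (.inr f), h => by
        obtain ⟨v, hv⟩ := hG.adj_of_dangling _ h
        exact ⟨.inr v, by simp only [TensorNetwork.attach, hv, Set.image_singleton]⟩
  adj_of_contracted
    | .inl j, _ => by
        obtain ⟨u, hu⟩ := hD.adj_of_dangling _ (hDι j)
        obtain ⟨v, hv⟩ := hG.adj_of_dangling _ (hGι j)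
        refine ⟨.inl u, .inr v, Sum.inl_ne_inr, ?_⟩
        simp only [TensorNetwork.attach, hu, hv, Set.image_singleton, Set.singleton_union]
    | .inr (.inl f), h => by
        obtain ⟨u, v, huv, he⟩ := hD.adj_of_contracted _ h
        refine ⟨.inl u, .inl v, Sum.inl_injective.ne huv, ?_⟩
        simp only [TensorNetwork.attach, he, Set.image_pair]
    | .inr (.inr f), h => by
        obtain ⟨u, v, huv, he⟩ := hG.adj_of_contracted _ h
        refine ⟨.inr u, .inr v, Sum.inr_injective.ne huv, ?_⟩
        simp only [TensorNetwork.attach, he, Set.image_pair]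

/-- The rank placing the `N` data tensors below the tensors of an embedding ordered by `ord`. -/
def dataFirst (N : ℕ) {n : ℕ} {V : Type*} (ord : V ≃ Fin n) : Fin N ⊕ V ↪ Fin N ⊕ₗ Fin n :=
  ((Equiv.sumCongr (Equiv.refl _) ord).trans toLex).toEmbedding

lemma dataFirst_inl_lt_inr {N n : ℕ} {V : Type*} (ord : V ≃ Fin n) (j : Fin N) (v : V) :
    dataFirst N ord (.inl j) < dataFirst N ord (.inr v) :=
  Sum.Lex.inl_lt_inr _ _

lemma dataFirst_inr_lt_inr_iff {N n : ℕ} {V : Type*} (ord : V ≃ Fin n) {u v : V} :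
    dataFirst N ord (.inr u) < dataFirst N ord (.inr v) ↔ ord u < ord v :=
  Sum.Lex.inr_lt_inr_iff

namespace TNEmbedding

variable {N : ℕ} {s : Fin N → ℕ} {hs : ∀ j, 0 < s j} {V F : Type*} {S : TNEmbedding (Fin N) V F}

/-- The network `(G_D, G_E)` of the embedding contracted with a Kronecker product of `N` vectors
of sizes `s j`. -/
abbrev withKronecker (S : TNEmbedding (Fin N) V F) (s : Fin N → ℕ) (hs : ∀ j, 0 < s j) :
    TensorNetwork (Fin N ⊕ V) (Fin N ⊕ Empty ⊕ F) :=
  (kroneckerData s hs).attach S.toTensorNetwork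

lemma isGraph_withKronecker : (S.withKronecker s hs).IsGraph :=
  (isGraph_kroneckerData s hs).attach ⟨S.adj_of_dangling, S.adj_of_contracted⟩
    (fun _ => Set.mem_univ _) S.input_dangling

lemma HasOutputSize.pos {m : ℕ} (h : S.HasOutputSize m) : 0 < m := by
  obtain ⟨f, -, rfl⟩ := h
  exact S.size_pos _

lemma HasOutputSize.dangling_subsingleton {m : ℕ} (h : S.HasOutputSize m) :
    (S.withKronecker s hs).dangling.Subsingleton := by
  obtain ⟨f₀, hf₀, -⟩ := h
  have key : ∀ e ∈ (S.withKronecker s hs).dangling, e = .inr (.inr f₀)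
    | .inr (.inr f), he => by rw [(hf₀ f).mp he]
  exact fun e he e' he' => (key e he).trans (key e' he').symm

variable {n : ℕ} {ord : V ≃ Fin n}

lemma inl_mem_outEdges_inl (j : Fin N) :
    .inl j ∈ (S.withKronecker s hs).outEdges (dataFirst N ord) (.inl j) := by
  obtain ⟨v, hv⟩ := S.adj_nonempty (.inl j)
  exact ⟨.inl ⟨j, rfl, rfl⟩, .inr ⟨.inr v, .inr ⟨v, hv, rfl⟩, dataFirst_inl_lt_inr ord j v⟩⟩

lemma inl_mem_sources (j : Fin N) :
    .inl j ∈ (S.withKronecker s hs).sources (dataFirst N ord) := by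
  rintro (i | f | f) he
  · obtain rfl : j = i := by
      simpa [TensorNetwork.attach, kroneckerData] using he
    exact inl_mem_outEdges_inl j
  · exact f.elim
  · simp [TensorNetwork.attach] at he

lemma le_ncard_sources [Finite V] :
    N ≤ ((S.withKronecker s hs).sources (dataFirst N ord)).ncard := by
  have hsub : Set.range Sum.inl ⊆ (S.withKronecker s hs).sources (dataFirst N ord) :=
    Set.range_subset_iff.mpr inl_mem_sources
  simpa [Set.ncard_range_of_injective Sum.inl_injective] using Set.ncard_le_ncard hsub

lemma inr_mem_outEdges_inr {f : F} {v : V} (hv : v ∈ S.adj (.inr f))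
    (hf : .inr f ∈ S.dangling ∨ ∃ u ∈ S.adj (.inr f), ord v < ord u) :
    .inr (.inr f) ∈ (S.withKronecker s hs).outEdges (dataFirst N ord) (.inr v) :=
  ⟨⟨v, hv, rfl⟩, hf.imp_right fun ⟨u, hu, hvu⟩ =>
    ⟨.inr u, ⟨u, hu, rfl⟩, (dataFirst_inr_lt_inr_iff ord).mpr hvu⟩⟩

open Classical in
/-- The dimensions along which the tensor `v` of the embedding is contracted with the data. -/
noncomputable def inputs (S : TNEmbedding (Fin N) V F) (v : V) : Finset (Fin N) :=
  {j | v ∈ S.adj (.inl j)}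

lemma sum_card_inputs [Fintype V] : ∑ v, (S.inputs v).card = N := by
  classical
  choose v hv using fun j => S.adj_of_dangling _ (S.input_dangling j)
  have hfiber : ∀ w, S.inputs w = ({j | v j = w} : Finset (Fin N)) := fun w => by
    simp only [inputs, hv, Set.mem_singleton_iff, eq_comm]
  simp only [hfiber, ← Finset.card_eq_sum_card_fiberwise fun _ _ => Finset.mem_coe.mpr
    (Finset.mem_univ (v _)), Finset.card_univ, Fintype.card_fin]

lemma rpow_le_mul_sum_card_inputs_rpow [Fintype V] (S : TNEmbedding (Fin N) V F) :
    (N : ℝ) ^ (7 / 2 : ℝ) ≤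
      (Fintype.card V : ℝ) ^ (5 / 2 : ℝ) * ∑ v, ((S.inputs v).card : ℝ) ^ (7 / 2 : ℝ) := by
  have h := Real.rpow_sum_le_const_mul_sum_rpow_of_nonneg Finset.univ
    (f := fun v => ((S.inputs v).card : ℝ)) (by norm_num : (1 : ℝ) ≤ 7 / 2)
    fun _ _ => Nat.cast_nonneg _
  rw [← Nat.cast_sum, sum_card_inputs, Finset.card_univ] at h
  norm_num at h ⊢
  exact h

section Weights

variable [Fintype V] [Fintype F] {ord : V ≃ Fin (Fintype.card V)}

lemma size_le_exp_outEdges_inl (j : Fin N) :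
    (s j : ℝ) ≤ Real.exp ((S.withKronecker s hs).totalWeight
      ((S.withKronecker s hs).outEdges (dataFirst N ord) (.inl j))) := by
  have h := (S.withKronecker s hs).prod_size_le_exp_totalWeight {j} .inl
    (by simpa using inl_mem_outEdges_inl (S := S) (hs := hs) (ord := ord) j)
  rwa [Finset.prod_singleton] at h

lemma rowSize_le_exp_outEdges_inr (v : V) :
    (S.rowSize ord v : ℝ) ≤ Real.exp ((S.withKronecker s hs).totalWeight
      ((S.withKronecker s hs).outEdges (dataFirst N ord) (.inr v))) := by
  classical
  rw [rowSize, Nat.cast_prod]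
  refine (S.withKronecker s hs).prod_size_le_exp_totalWeight _
    (Function.Embedding.inr.trans .inr) fun f hf => ?_
  obtain ⟨hv, hf⟩ := (Finset.mem_filter.mp hf).2
  exact inr_mem_outEdges_inr hv hf

lemma rowSize_mul_prod_inputs_le_exp_boundary (ord : V ≃ Fin (Fintype.card V)) (v : V) :
    (S.rowSize ord v : ℝ) * ∏ j ∈ S.inputs v, (s j : ℝ) ≤ Real.exp
      ((S.withKronecker s hs).totalWeight ((S.withKronecker s hs).boundary {.inr v})) := by
  have hinputs : ∏ j ∈ S.inputs v, (s j : ℝ) ≤ Real.exp ((S.withKronecker s hs).totalWeight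
      (Sum.inl '' (S.inputs v : Set (Fin N)))) :=
    (S.withKronecker s hs).prod_size_le_exp_totalWeight _ .inl
      fun j hj => Set.mem_image_of_mem Sum.inl hj
  refine (mul_le_mul (rowSize_le_exp_outEdges_inr (hs := hs) v) hinputs
    (Finset.prod_nonneg fun j _ => Nat.cast_nonneg _) (Real.exp_nonneg _)).trans ?_
  rw [← Real.exp_add, Real.exp_le_exp]
  refine (S.withKronecker s hs).totalWeight_add_le ?_
    TensorNetwork.outEdges_subset_boundary_singleton ?_
  · refine Set.disjoint_right.mpr ?_
    rintro _ ⟨j, -, rfl⟩ hj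
    exact Sum.inr_ne_inl (isGraph_withKronecker.eq_of_mem_outEdges hj (inl_mem_outEdges_inl j))
  · rintro _ ⟨j, hj, rfl⟩
    have hvj : v ∈ S.adj (.inl j) := by simpa [inputs] using hj
    exact (TensorNetwork.mem_boundary_iff _).mpr ⟨⟨.inr v, rfl, .inr ⟨v, hvj, rfl⟩⟩,
      .inr ⟨.inl j, Sum.inl_ne_inr, .inl ⟨j, rfl, rfl⟩⟩⟩

end Weights

end TNEmbedding

/-! ### The cost of contracting an admissible embedding -/

lemma pow_four_le_mul_two_pow (d : ℕ) : (d : ℝ) ^ 4 ≤ 384 * 2 ^ d := by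
  have htaylor : (d * Real.log 2) ^ 4 / 24 ≤ 2 ^ d := by
    simpa [Nat.factorial, mul_comm, Real.exp_nat_mul, Real.exp_log] using
      Real.pow_div_factorial_le_exp (d * Real.log 2) (by positivity) 4
  have hlog : (1 / 2 : ℝ) ^ 4 ≤ Real.log 2 ^ 4 :=
    pow_le_pow_left₀ (by norm_num) (by linarith [Real.log_two_gt_d9]) 4
  have hd := mul_le_mul_of_nonneg_left hlog (pow_nonneg (Nat.cast_nonneg (α := ℝ) d) 4)
  rw [mul_pow] at htaylor
  linarith

lemma rpow_mul_card_rpow_le_prod {ι : Type*} (J : Finset ι) {f : ι → ℝ} {x : ℝ} (hx : 0 ≤ x)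
    (hf : ∀ j ∈ J, 2 ≤ f j) (hxf : ∀ j ∈ J, x ≤ f j) :
    x ^ (3 / 2 : ℝ) * (J.card : ℝ) ^ (7 / 2 : ℝ) ≤
      1536 * ∏ j ∈ J, f j + J.card * x ^ (3 / 2 : ℝ) := by
  have hprod : 0 ≤ ∏ j ∈ J, f j := Finset.prod_nonneg fun j hj => by linarith [hf j hj]
  rcases Nat.lt_or_ge J.card 2 with hcard | hcard
  · interval_cases J.card
    · simpa using hprod
    · simpa using hprod
  set d := J.card with hd
  set M := max x 2
  have hM : 2 ≤ M := le_max_right x 2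
  have hxM : x ^ (3 / 2 : ℝ) ≤ M ^ 2 := calc
    x ^ (3 / 2 : ℝ) ≤ M ^ (3 / 2 : ℝ) := Real.rpow_le_rpow hx (le_max_left x 2) (by norm_num)
    _ ≤ M ^ (2 : ℝ) := Real.rpow_le_rpow_of_exponent_le (by linarith) (by norm_num)
    _ = M ^ 2 := Real.rpow_two M
  have hd4 : (d : ℝ) ^ (7 / 2 : ℝ) ≤ 1536 * M ^ (d - 2) := calc
    (d : ℝ) ^ (7 / 2 : ℝ) ≤ (d : ℝ) ^ (4 : ℝ) :=
      Real.rpow_le_rpow_of_exponent_le (by exact_mod_cast one_le_two.trans hcard) (by norm_num)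
    _ = (d : ℝ) ^ 4 := by norm_cast
    _ ≤ 384 * 2 ^ d := pow_four_le_mul_two_pow d
    _ = 1536 * 2 ^ (d - 2) := by rw [← Nat.sub_add_cancel hcard, pow_add]; norm_num; ring
    _ ≤ 1536 * M ^ (d - 2) := by gcongr
  calc x ^ (3 / 2 : ℝ) * (d : ℝ) ^ (7 / 2 : ℝ) ≤ M ^ 2 * (1536 * M ^ (d - 2)) := by gcongr
    _ = 1536 * M ^ d := by rw [mul_left_comm, ← pow_add, Nat.add_sub_cancel' hcard]
    _ ≤ 1536 * ∏ j ∈ J, f j := by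
      gcongr
      rw [hd, ← Finset.prod_const]
      exact Finset.prod_le_prod (fun _ _ => by positivity) fun j hj => max_le (hxf j hj) (hf j hj)
    _ ≤ 1536 * ∏ j ∈ J, f j + d * x ^ (3 / 2 : ℝ) := le_add_of_nonneg_right (by positivity)

namespace TNEmbedding

variable {N : ℕ} {s : Fin N → ℕ} {hs : ∀ j, 0 < s j} {V F : Type*} [Fintype V] [Fintype F]
  {S : TNEmbedding (Fin N) V F} {T : ContractionTree (Fin N ⊕ V)} {x : ℝ}
  {ord : V ≃ Fin (Fintype.card V)}

lemma le_exp_outEdges (hrow : ∀ v, x ≤ S.rowSize ord v) (hxs : ∀ j, x ≤ s j) :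
    ∀ v, x ≤ Real.exp ((S.withKronecker s hs).totalWeight
      ((S.withKronecker s hs).outEdges (dataFirst N ord) v))
  | .inl j => (hxs j).trans (size_le_exp_outEdges_inl j)
  | .inr v => (hrow v).trans (rowSize_le_exp_outEdges_inr v)

lemma nontrivial_vertices (hN : 2 ≤ N) (V : Type*) : Nontrivial (Fin N ⊕ V) :=
  have := Fin.nontrivial_iff_two_le.mpr hN
  Sum.inl_injective.nontrivial

theorem mul_sum_size_le_cost (hN : 2 ≤ N) (hx : 0 < x) (hrow : ∀ v, x ≤ S.rowSize ord v)
    (hxs : ∀ j, x ≤ s j) (hT : T.IsFull) :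
    x * ∑ j, (s j : ℝ) ≤ 2 * T.cost (S.withKronecker s hs) := by
  have := nontrivial_vertices hN V
  have hcost := isGraph_withKronecker.exp_mul_sum_exp_outEdges_le_cost
    (fun v => (Real.log_le_iff_le_exp hx).mpr (le_exp_outEdges (hs := hs) hrow hxs v)) hT
  rw [Real.exp_log hx] at hcost
  refine (mul_le_mul_of_nonneg_left ?_ hx.le).trans hcost
  rw [Fintype.sum_sum_type]
  exact (Finset.sum_le_sum fun j _ => size_le_exp_outEdges_inl j).trans
    (le_add_of_nonneg_right (Finset.sum_nonneg fun _ _ => Real.exp_nonneg _))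

theorem mul_rpow_le_cost {m : ℕ} (hN : 2 ≤ N) (hx : 0 < x) (hrow : ∀ v, x ≤ S.rowSize ord v)
    (hxs : ∀ j, x ≤ s j) (hm : S.HasOutputSize m) (hT : T.IsFull) :
    N * x ^ (5 / 2 : ℝ) ≤ 8 * T.cost (S.withKronecker s hs) := by
  rcases le_or_gt x 1 with hx1 | hx1
  · have hxx : x ^ (5 / 2 : ℝ) ≤ x := by
      simpa using Real.rpow_le_rpow_of_exponent_ge hx hx1 (by norm_num : (1 : ℝ) ≤ 5 / 2)
    have hNs : (N : ℝ) ≤ ∑ j, (s j : ℝ) := by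
      simpa using Finset.sum_le_sum fun j (_ : j ∈ Finset.univ) =>
        (by exact_mod_cast hs j : (1 : ℝ) ≤ s j)
    have hcost := mul_sum_size_le_cost (hs := hs) hN hx hrow hxs hT
    have h := mul_le_mul hNs hxx (Real.rpow_nonneg hx.le _) (by positivity)
    have hpos : 0 ≤ x * ∑ j, (s j : ℝ) := by positivity
    linarith
  · have hcost := isGraph_withKronecker.exp_mul_ncard_sources_le_cost (Real.log_pos hx1)
      (fun v => (Real.log_le_iff_le_exp hx).mpr (le_exp_outEdges (hs := hs) hrow hxs v))
      hm.dangling_subsingleton hT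
    rw [mul_comm (5 / 2 : ℝ), ← Real.rpow_def_of_pos hx] at hcost
    have hX : 0 < x ^ (5 / 2 : ℝ) := Real.rpow_pos_of_pos hx _
    have hsources := mul_le_mul_of_nonneg_left (Nat.cast_le (α := ℝ).mpr
      (le_ncard_sources (S := S) (hs := hs) (ord := ord))) hX.le
    have hN' := mul_le_mul_of_nonneg_left (Nat.ofNat_le_cast (α := ℝ).mpr hN) hX.le
    linarith

lemma rpow_mul_card_inputs_rpow_le_exp_boundary (hx : 0 < x) (hrow : ∀ v, x ≤ S.rowSize ord v)
    (hxs : ∀ j, x ≤ s j) (hs2 : ∀ j, 2 ≤ s j) (v : V) :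
    x ^ (5 / 2 : ℝ) * ((S.inputs v).card : ℝ) ^ (7 / 2 : ℝ) ≤
      1536 * Real.exp ((S.withKronecker s hs).totalWeight
        ((S.withKronecker s hs).boundary {.inr v})) + (S.inputs v).card * x ^ (5 / 2 : ℝ) := by
  have hx52 : x ^ (5 / 2 : ℝ) = x * x ^ (3 / 2 : ℝ) := by
    rw [← Real.rpow_one_add' hx.le (by norm_num)]
    norm_num
  have hboundary : x * ∏ j ∈ S.inputs v, (s j : ℝ) ≤ Real.exp
      ((S.withKronecker s hs).totalWeight ((S.withKronecker s hs).boundary {.inr v})) :=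
    (mul_le_mul_of_nonneg_right (hrow v) (Finset.prod_nonneg fun j _ => Nat.cast_nonneg _)).trans
      (rowSize_mul_prod_inputs_le_exp_boundary ord v)
  have hprod := mul_le_mul_of_nonneg_left (rpow_mul_card_rpow_le_prod (S.inputs v) hx.le
    (fun j _ => Nat.ofNat_le_cast (α := ℝ).mpr (hs2 j)) fun j _ => hxs j) hx.le
  rw [hx52]
  linarith

theorem mul_div_rpow_le_cost {m : ℕ} (hN : 2 ≤ N) (hx : 0 < x)
    (hrow : ∀ v, x ≤ S.rowSize ord v) (hxs : ∀ j, x ≤ s j) (hs2 : ∀ j, 2 ≤ s j)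
    (hm : S.HasOutputSize m) (hT : T.IsFull) :
    N * (N * (x / Fintype.card V)) ^ (5 / 2 : ℝ) ≤ 3080 * T.cost (S.withKronecker s hs) := by
  have := nontrivial_vertices hN V
  set n := Fintype.card V
  have hN0 : (0 : ℝ) < N := by exact_mod_cast two_pos.trans_le hN
  have hboundary : ∑ v : V, Real.exp ((S.withKronecker s hs).totalWeight
      ((S.withKronecker s hs).boundary {.inr v})) ≤ 2 * T.cost (S.withKronecker s hs) := by
    refine le_trans ?_ (hT.sum_exp_boundary_le_cost (G := S.withKronecker s hs))
    rw [Fintype.sum_sum_type]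
    exact le_add_of_nonneg_left (Finset.sum_nonneg fun _ _ => Real.exp_nonneg _)
  have hsum : x ^ (5 / 2 : ℝ) * ∑ v, ((S.inputs v).card : ℝ) ^ (7 / 2 : ℝ) ≤
      3080 * T.cost (S.withKronecker s hs) := by
    have h := Finset.sum_le_sum fun v (_ : v ∈ Finset.univ) =>
      rpow_mul_card_inputs_rpow_le_exp_boundary (hs := hs) hx hrow hxs hs2 v
    rw [← Finset.mul_sum, Finset.sum_add_distrib, ← Finset.mul_sum, ← Finset.sum_mul,
      ← Nat.cast_sum, sum_card_inputs] at h
    linarith [mul_rpow_le_cost (hs := hs) hN hx hrow hxs hm hT]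
  obtain ⟨v⟩ : Nonempty V := ⟨(S.adj_nonempty (.inl ⟨0, by omega⟩)).choose⟩
  have hn : 0 < (n : ℝ) ^ (5 / 2 : ℝ) := by
    have : 0 < n := Fintype.card_pos_iff.mpr ⟨v⟩
    positivity
  have hN72 : (N : ℝ) * (N : ℝ) ^ (5 / 2 : ℝ) = (N : ℝ) ^ (7 / 2 : ℝ) := by
    rw [← Real.rpow_one_add' hN0.le (by norm_num)]
    norm_num
  rw [Real.mul_rpow hN0.le (by positivity), Real.div_rpow hx.le (by positivity), ← mul_assoc, hN72,
    mul_div_assoc', div_le_iff₀ hn]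
  calc (N : ℝ) ^ (7 / 2 : ℝ) * x ^ (5 / 2 : ℝ)
      ≤ ((n : ℝ) ^ (5 / 2 : ℝ) * ∑ v, ((S.inputs v).card : ℝ) ^ (7 / 2 : ℝ)) * x ^ (5 / 2 : ℝ) := by
        gcongr
        exact S.rpow_le_mul_sum_card_inputs_rpow
    _ = (n : ℝ) ^ (5 / 2 : ℝ) * (x ^ (5 / 2 : ℝ) * ∑ v, ((S.inputs v).card : ℝ) ^ (7 / 2 : ℝ)) := by
        ring
    _ ≤ _ := by
        rw [mul_comm]
        gcongr

variable {a b₁ b₂ ε δ : ℝ} {m : ℕ}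

/-- The quantity `N_E * log (1 / δ) / ε ^ 2` to which the row sizes and the sketch size of an
admissible embedding are compared. -/
noncomputable abbrev sketchScale (V : Type*) [Fintype V] (ε δ : ℝ) : ℝ :=
  Fintype.card V * Real.log (1 / δ) / ε ^ 2

namespace Admissible

lemma sketchScale_pos (h : S.Admissible a b₁ b₂ ε δ m) (hb₂ : 0 < b₂) : 0 < sketchScale V ε δ :=
  pos_of_mul_pos_right ((Nat.cast_pos.mpr h.output.pos).trans_le h.upper) hb₂.le

lemma min_mul_sketchScale_le (h : S.Admissible a b₁ b₂ ε δ m) (hb₂ : 0 < b₂) :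
    min a b₁ * sketchScale V ε δ ≤ m :=
  (mul_le_mul_of_nonneg_right (min_le_right a b₁) (h.sketchScale_pos hb₂).le).trans h.lower

lemma exists_min_mul_sketchScale_le_rowSize (h : S.Admissible a b₁ b₂ ε δ m) (hb₂ : 0 < b₂) :
    ∃ ord : V ≃ Fin (Fintype.card V), ∀ v, min a b₁ * sketchScale V ε δ ≤ S.rowSize ord v :=
  h.sufficient.imp fun _ hrow v =>
    (mul_le_mul_of_nonneg_right (min_le_left a b₁) (h.sketchScale_pos hb₂).le).trans (hrow v)

theorem sum_mul_add_mul_rpow_le_cost (h : S.Admissible a b₁ b₂ ε δ m) (ha : 0 < a) (hb₁ : 0 < b₁)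
    (hb₂ : 0 < b₂) (hN : 2 ≤ N) (hms : ∀ j, m < s j) (hT : T.IsFull) :
    ∑ j, (s j : ℝ) * m + N * (m : ℝ) ^ (5 / 2 : ℝ) ≤
      (2 * (b₂ / min a b₁) + 8 * (b₂ / min a b₁) ^ (5 / 2 : ℝ)) *
        T.cost (S.withKronecker s hs) := by
  obtain ⟨ord, hrow⟩ := h.exists_min_mul_sketchScale_le_rowSize hb₂
  have hβ : 0 < min a b₁ := lt_min ha hb₁
  set x := min a b₁ * sketchScale V ε δ with hx_def
  have hx : 0 < x := mul_pos hβ (h.sketchScale_pos hb₂)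
  have hxs : ∀ j, x ≤ s j := fun j =>
    (h.min_mul_sketchScale_le hb₂).trans (Nat.cast_le.mpr (hms j).le)
  have hmx : (m : ℝ) ≤ b₂ / min a b₁ * x := by
    rw [hx_def, ← mul_assoc, div_mul_cancel₀ _ hβ.ne']
    exact h.upper
  have hκ : 0 < b₂ / min a b₁ := div_pos hb₂ hβ
  have hsum := calc ∑ j, (s j : ℝ) * m
      ≤ ∑ j, (s j : ℝ) * (b₂ / min a b₁ * x) := by gcongr
    _ = b₂ / min a b₁ * (x * ∑ j, (s j : ℝ)) := by rw [← Finset.sum_mul]; ring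
    _ ≤ b₂ / min a b₁ * (2 * T.cost (S.withKronecker s hs)) :=
      mul_le_mul_of_nonneg_left (mul_sum_size_le_cost hN hx hrow hxs hT) hκ.le
  have hrpow := calc (N : ℝ) * (m : ℝ) ^ (5 / 2 : ℝ)
      ≤ N * (b₂ / min a b₁ * x) ^ (5 / 2 : ℝ) := by gcongr
    _ = (b₂ / min a b₁) ^ (5 / 2 : ℝ) * (N * x ^ (5 / 2 : ℝ)) := by
      rw [Real.mul_rpow hκ.le hx.le]
      ring
    _ ≤ (b₂ / min a b₁) ^ (5 / 2 : ℝ) * (8 * T.cost (S.withKronecker s hs)) :=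
      mul_le_mul_of_nonneg_left (mul_rpow_le_cost hN hx hrow hxs h.output hT) (by positivity)
  linarith

theorem mul_mul_rpow_le_cost (h : S.Admissible a b₁ b₂ ε δ m) (ha : 0 < a) (hb₁ : 0 < b₁)
    (hb₂ : 0 < b₂) (hN : 2 ≤ N) (hms : ∀ j, m < s j) (hT : T.IsFull) :
    N * (N * Real.log (1 / δ) / ε ^ 2) ^ (5 / 2 : ℝ) ≤
      3080 / min a b₁ ^ (5 / 2 : ℝ) * T.cost (S.withKronecker s hs) := by
  obtain ⟨ord, hrow⟩ := h.exists_min_mul_sketchScale_le_rowSize hb₂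
  have hβ : 0 < min a b₁ := lt_min ha hb₁
  have hscale := h.sketchScale_pos hb₂
  have hn : (Fintype.card V : ℝ) ≠ 0 := fun hn => by simp [sketchScale, hn] at hscale
  have hcost := mul_div_rpow_le_cost (hs := hs) hN (mul_pos hβ hscale) hrow
    (fun j => (h.min_mul_sketchScale_le hb₂).trans (Nat.cast_le.mpr (hms j).le))
    (fun j => (Nat.succ_le_of_lt h.output.pos).trans_lt (hms j)) h.output hT
  have hscale_div : (N : ℝ) * Real.log (1 / δ) / ε ^ 2 =
      N * (sketchScale V ε δ / Fintype.card V) := by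
    rw [sketchScale]
    field_simp
  rw [mul_div_assoc, mul_left_comm (N : ℝ), Real.mul_rpow hβ.le (by positivity)] at hcost
  rw [hscale_div, div_mul_eq_mul_div, le_div_iff₀ (by positivity)]
  linarith

end Admissible

end TNEmbedding

theorem corollaryE1 (a b₁ b₂ : ℝ) (ha : 0 < a) (hb₁ : 0 < b₁) (hb₂ : 0 < b₂) :
    ∃ c : ℝ, 0 < c ∧
      ∀ (N : ℕ) (_ : 2 ≤ N) (ε δ : ℝ) (_ : 0 < ε) (_ : 0 < δ) (_ : δ < 1)
        (s : Fin N → ℕ) (hs : ∀ j, 0 < s j)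
        (V F : Type*) [Fintype V] [Fintype F] (S : TNEmbedding (Fin N) V F) (m : ℕ)
        (_ : ∀ j, S.size (Sum.inl j) = s j)
        (_ : S.Admissible a b₁ b₂ ε δ m)
        (_ : ∀ j, m < s j)
        (T : ContractionTree (Fin N ⊕ V)) (_ : T.IsFull),
        c * ((∑ j, (s j : ℝ) * m) + N * (m : ℝ) ^ (5 / 2 : ℝ)) ≤
            T.cost ((kroneckerData s hs).attach S.toTensorNetwork) ∧
          c * (N * (N * Real.log (1 / δ) / ε ^ 2) ^ (5 / 2 : ℝ)) ≤
            T.cost ((kroneckerData s hs).attach S.toTensorNetwork) := by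
  have := lt_min ha hb₁
  set C₁ := 2 * (b₂ / min a b₁) + 8 * (b₂ / min a b₁) ^ (5 / 2 : ℝ)
  set C₂ := 3080 / min a b₁ ^ (5 / 2 : ℝ)
  have hC₁ : 0 < C₁ := by positivity
  have hC₂ : 0 < C₂ := by positivity
  refine ⟨min C₁⁻¹ C₂⁻¹, lt_min (inv_pos.mpr hC₁) (inv_pos.mpr hC₂), ?_⟩
  intro N hN ε δ _ hδ hδ1 s hs V F _ _ S m _ hS hms T hT
  have hlog : 0 ≤ Real.log (1 / δ) := Real.log_nonneg (one_le_one_div hδ hδ1.le)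
  constructor
  · refine (mul_le_mul_of_nonneg_right (min_le_left _ _) (by positivity)).trans ?_
    exact (inv_mul_le_iff₀ hC₁).mpr (hS.sum_mul_add_mul_rpow_le_cost ha hb₁ hb₂ hN hms hT)
  · refine (mul_le_mul_of_nonneg_right (min_le_right _ _) (by positivity)).trans ?_
    exact (inv_mul_le_iff₀ hC₂).mpr (hS.mul_mul_rpow_le_cost ha hb₁ hb₂ hN hms hT)
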